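/- For a graph $F$ and $n\ge 0$, let $ex^*(n,F)$ be the maximum number of edges of a graph on $n$ vertices that has a proper edge coloring without a rainbow copy of $F$ (a not necessarily induced copy of $F$ whose edges have pairwise different colors). For $1\le d\le k$, the broom $B_{k,d}$ is the tree with $k$ edges consisting of a path with $d$ edges together with $k-d$ further leaves attached to one endpoint of that path. Let $K^*_{2^s}$ be the complete graph on the vertex set $\mathbb{F}_2^s$ in which the edge $vw$ has color $v-w$. **Lemma.** Let $4\le d\le 9$, $s\ge 2$, and $k=2^s-1$ with $d\le k$. Then: 1. $ex^*(n,B_{k,d})\ge \frac{k}{2}n+O(1)$; that is, there is a constant $C$, depending only on $k$ and $d$, such that $ex^*(n,B_{k,d})\ge \frac{k}{2}n-C$ for all $n\ge 0$. 2. $K^*_{2^s}$ contains no rainbow copy of $B_{k,d}$. 3. For no $m\ge 0$ are there $d$ pairwise distinct nonzero vectors $w_1,\dots,w_d\in\mathbb{F}_2^m$ whose partial sums $w_1+\dots+w_a$, $1\le a\le d$, are pairwise distinct and all belong to $\{w_1,\dots,w_d\}$. -/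

import Mathlib

namespace RainbowTuran

/-- An edge coloring is proper if distinct edges that share a vertex receive different colors. -/
def IsProper {V K : Type*} {G : SimpleGraph V} (c : G.EdgeLabeling K) : Prop :=
  ∀ e f : G.edgeSet, e ≠ f → (∃ v, v ∈ (e : Sym2 V) ∧ v ∈ (f : Sym2 V)) → c e ≠ c f

/-- The edge-colored graph `(G, c)` contains a rainbow copy of `F`: a (not necessarily induced)
copy of `F` in `G` whose edges receive pairwise different colors. -/
def HasRainbowCopy {V W K : Type*} (F : SimpleGraph W) {G : SimpleGraph V}
    (c : G.EdgeLabeling K) : Prop :=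
  ∃ φ : F.Copy G, Function.Injective fun e : F.edgeSet => c (φ.toHom.mapEdgeSet e)

/-- The numbers of edges of the properly edge-colored graphs on `n` vertices
without a rainbow copy of `F`. -/
def rainbowFreeSizes {W : Type*} (n : ℕ) (F : SimpleGraph W) : Set ℕ :=
  {m | ∃ (G : SimpleGraph (Fin n)) (c : G.EdgeLabeling ℕ),
    IsProper c ∧ ¬ HasRainbowCopy F c ∧ G.edgeSet.ncard = m}

/-- The rainbow Turán number `ex*(n, F)`: the maximum of `rainbowFreeSizes n F`. -/
noncomputable def exStar {W : Type*} (n : ℕ) (F : SimpleGraph W) : ℕ :=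
  sSup (rainbowFreeSizes n F)

theorem bddAbove_rainbowFreeSizes {W : Type*} (n : ℕ) (F : SimpleGraph W) :
    BddAbove (rainbowFreeSizes n F) := by
  refine ⟨Nat.card (Sym2 (Fin n)), ?_⟩
  rintro m ⟨G, c, -, -, rfl⟩
  exact Set.ncard_le_card _

/-- If `F` has an edge, then `ex*(n, F)` is attained. -/
theorem exStar_mem {W : Type*} (n : ℕ) (F : SimpleGraph W) (hF : F.edgeSet.Nonempty) :
    exStar n F ∈ rainbowFreeSizes n F := by
  refine Nat.sSup_mem ⟨0, ⊥, fun _ => 0, ?_, ?_, by simp⟩ (bddAbove_rainbowFreeSizes n F)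
  · intro e
    exact absurd e.2 (by simp)
  · rintro ⟨φ, -⟩
    obtain ⟨e, he⟩ := hF
    exact absurd (φ.toHom.mapEdgeSet ⟨e, he⟩).2 (by simp)

/-- The broom `B_{k,l}` (for `1 ≤ l ≤ k`), a tree on the `k + 1` vertices `0, …, k`: the broom
stick is the path `0, 1, …, l` with `l` edges, and the `k - l` vertices `l + 1, …, k` are leaves
attached to the centre `0` of the star. -/
def broom (k l : ℕ) : SimpleGraph (Fin (k + 1)) :=
  SimpleGraph.fromRel fun i j =>
    (j.val = i.val + 1 ∧ j.val ≤ l) ∨ (i.val = 0 ∧ l < j.val)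

/-- The edge coloring `c(vw) = v - w` of the complete graph on `𝔽₂ˢ`; this edge-colored graph
is `K*_{2^s}`. -/
def cubeColoring (s : ℕ) :
    (⊤ : SimpleGraph (Fin s → ZMod 2)).EdgeLabeling (Fin s → ZMod 2) :=
  fun e => Sym2.lift ⟨fun v w => v - w, fun v w => by
    funext i
    exact (by decide : ∀ a b : ZMod 2, a - b = b - a) (v i) (w i)⟩ (e : Sym2 (Fin s → ZMod 2))

end RainbowTuran

/-! A broom with `k = 2 ^ s - 1` edges spans `K*_{2^s}`, and a rainbow copy uses every nonzero
vector exactly once as a color. Translate the centre to `0`: a leaf edge has its leaf as color, so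
the stick colors `w_1, …, w_d` are exactly the remaining nonzero vectors, namely the stick vertices
other than the centre. These are the partial sums of the `w_i`, so part 2 follows from part 3.

For part 3, partial sums in the sequence give an injection `σ` with `w (σ (a + 1)) = w (σ a) + w (a
+ 1)`. A finite search over all `σ` shows that these linear relations always force some `w i = 0` or
`w i = w j`.

For part 1, take disjoint copies of `K*_{2^s}`: a broom is connected, so it would lie in one copy.
-/

namespace RainbowTuran

/-! ### Linear relations as bit masks, and the search -/

/-- The sum of the values `w i` over the binary digits `i < D` of `n` that are equal to one. -/
def bitSum {M : Type*} [AddCommMonoid M] (D : ℕ) (w : ℕ → M) (n : ℕ) : M :=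
  ∑ i ∈ Finset.range D, if n.testBit i then w i else 0

theorem bitSum_zero {M : Type*} [AddCommMonoid M] (D : ℕ) (w : ℕ → M) :
    bitSum D w 0 = 0 := by
  simp [bitSum]

theorem bitSum_two_pow {M : Type*} [AddCommMonoid M] {D i : ℕ} (w : ℕ → M) (hi : i < D) :
    bitSum D w (2 ^ i) = w i := by
  simp [bitSum, Nat.testBit_two_pow, hi]

theorem bitSum_xor {M : Type*} [AddCommMonoid M] (h2 : ∀ x : M, x + x = 0) (D : ℕ)
    (w : ℕ → M) (m n : ℕ) : bitSum D w (m ^^^ n) = bitSum D w m + bitSum D w n := by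
  unfold bitSum
  rw [← Finset.sum_add_distrib]
  refine Finset.sum_congr rfl fun i _ => ?_
  rw [Nat.testBit_xor]
  cases m.testBit i <;> cases n.testBit i <;> simp [h2]

/-- Clears the leading binary digit of `r` from the entries of `v` by adding `r` to them. -/
def eliminate (r : ℕ) (v : List ℕ) : List ℕ :=
  v.map fun x => bif x.testBit r.log2 then x ^^^ r else x

theorem bitSum_eliminate {M : Type*} [AddCommMonoid M] (h2 : ∀ x : M, x + x = 0) {D r : ℕ}
    {w : ℕ → M} (hr : bitSum D w r = 0) (v : List ℕ) :
    (eliminate r v).map (bitSum D w) = v.map (bitSum D w) := by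
  rw [eliminate, List.map_map]
  refine List.map_congr_left fun x _ => ?_
  cases h : x.testBit r.log2 <;> simp [h, bitSum_xor h2, hr]

/-- Backtracking search over the permutations `σ` of `0, …, d - 1` for a solution of
`w (σ a) = w (σ (a - 1)) + w a` in distinct nonzero vectors `w 0, …, w (d - 1)` over the field
with two elements. The value `true` means that no solution exists. The entries of `v` express
`w 0, …, w (d - 1)` modulo the relations found so far, `t` values of `σ` are still to be chosen,
`last` is the value chosen last and `avail` contains the admissible ones. -/
def searchFails (d : ℕ) : ℕ → List ℕ → ℕ → List ℕ → Bool
  | 0, _, _, _ => false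
  | t + 1, v, last, avail => avail.all fun j =>
      -- The relation imposed is `w j + w last + w (d - (t + 1)) = 0`; a zero or repeated entry
      -- afterwards refutes the branch.
      let v' := eliminate (v.getD j 0 ^^^ v.getD last 0 ^^^ v.getD (d - (t + 1)) 0) v
      !decide (0 :: v').Nodup || searchFails d t v' j (avail.filter (· != j))

/-- Soundness of the search: an actual solution survives along its own branch. Each imposed relation
holds for `w`, so the masks keep evaluating to the distinct nonzero `w i`, and the pruning test
cannot fire. -/
theorem searchFails_eq_false {M : Type*} [AddCommMonoid M] (h2 : ∀ x : M, x + x = 0) {d : ℕ}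
    {w : ℕ → M} (hw0 : ∀ i < d, w i ≠ 0) (hw : Set.InjOn w (Set.Iio d)) {σ : ℕ → ℕ}
    (hσd : ∀ a < d, σ a < d) (hσ : Set.InjOn σ (Set.Iio d))
    (hstep : ∀ a, a + 1 < d → w (σ (a + 1)) = w (σ a) + w (a + 1)) :
    ∀ (t a : ℕ) (v : List ℕ) (avail : List ℕ), a + 1 + t = d →
      v.map (bitSum d w) = (List.range d).map w →
      (∀ b, a < b → b < d → σ b ∈ avail) → searchFails d t v (σ a) avail = false := by
  intro t
  induction t with
  | zero => intros; rfl
  | succ t ih =>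
    intro a v avail ha hv havail
    have hget : ∀ i < d, bitSum d w (v.getD i 0) = w i := by
      intro i hi
      have := congrArg (fun l => l.getD i 0) hv
      have hlen : v.length = d := by simpa using congrArg List.length hv
      simpa [List.getD_eq_getElem?_getD, hi, hlen] using this
    have hda : d - (t + 1) = a + 1 := by omega
    rw [searchFails, List.all_eq_false]
    refine ⟨σ (a + 1), havail _ (by omega) (by omega), ?_⟩
    have hr : bitSum d w (v.getD (σ (a + 1)) 0 ^^^ v.getD (σ a) 0 ^^^ v.getD (a + 1) 0) = 0 := by
      rw [bitSum_xor h2, bitSum_xor h2, hget _ (hσd _ (by omega)), hget _ (hσd _ (by omega)),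
        hget _ (by omega), add_assoc, ← hstep a (by omega), h2]
    have hv' := (bitSum_eliminate h2 hr v).trans hv
    rw [hda]
    have hnodup : (0 :: eliminate (v.getD (σ (a + 1)) 0 ^^^ v.getD (σ a) 0 ^^^
        v.getD (a + 1) 0) v).Nodup := by
      refine List.Nodup.of_map (bitSum d w) ?_
      rw [List.map_cons, hv', bitSum_zero, List.nodup_cons]
      refine ⟨?_, (List.nodup_map_iff_inj_on List.nodup_range).2 ?_⟩
      · simpa using hw0
      · intro x hx y hy h
        exact hw (List.mem_range.1 hx) (List.mem_range.1 hy) h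
    have := ih (a + 1) _ (avail.filter (· != σ (a + 1))) (by omega) hv' (by
      intro b hb hbd
      have hne : σ b ≠ σ (a + 1) := fun h => by
        have := hσ (Set.mem_Iio.2 hbd) (Set.mem_Iio.2 (by omega)) h
        omega
      simpa [hne] using havail b (by omega) hbd)
    simp only [this, hnodup]
    simp

theorem searchFails_start {d : ℕ} (hd4 : 4 ≤ d) (hd9 : d ≤ 9) :
    searchFails d (d - 1) ((List.range d).map (2 ^ ·)) 0 (List.range d).tail = true := by
  interval_cases d <;> decide +kernel

/-- For `4 ≤ d ≤ 9`, in characteristic two no sequence of `d` distinct nonzero vectors has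
distinct partial sums that all belong to the sequence. -/
theorem not_exists_partialSums_mem {M : Type*} [AddCommMonoid M] (h2 : ∀ x : M, x + x = 0)
    {d : ℕ} (hd4 : 4 ≤ d) (hd9 : d ≤ 9) :
    ¬ ∃ w : Fin d → M, Function.Injective w ∧ (∀ i, w i ≠ 0) ∧
      Function.Injective (fun a : Fin d => ∑ i ∈ Finset.Iic a, w i) ∧
      ∀ a : Fin d, ∑ i ∈ Finset.Iic a, w i ∈ Set.range w := by
  rintro ⟨w, hw, hw0, hS, hmem⟩
  choose τ hτ using hmem
  have hτinj : Function.Injective τ := fun a b h => hS (by simp only [← hτ, h])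
  let w' : ℕ → M := fun n => if h : n < d then w ⟨n, h⟩ else 0
  let σ : ℕ → ℕ := fun n => if h : n < d then τ ⟨n, h⟩ else 0
  have hw' : ∀ {n} (h : n < d), w' n = w ⟨n, h⟩ := fun h => dif_pos h
  have hσ' : ∀ {n} (h : n < d), σ n = τ ⟨n, h⟩ := fun h => dif_pos h
  have hσd : ∀ a < d, σ a < d := fun a ha => by rw [hσ' ha]; exact (τ _).2
  have hsum : ∀ a (ha : a < d), w' (σ a) = ∑ i ∈ Finset.Iic (⟨a, ha⟩ : Fin d), w i := by
    intro a ha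
    rw [hw' (hσd a ha), ← hτ]
    congr 1
    exact Fin.ext (hσ' ha)
  have hwinj : Set.InjOn w' (Set.Iio d) := by
    intro a ha b hb h
    rw [hw' ha, hw' hb] at h
    exact Fin.mk.inj_iff.1 (hw h)
  have h0 : 0 < d := by omega
  -- The first partial sum is `w 0` itself, which is why the search starts with `last = 0`.
  have hσ0 : σ 0 = 0 := by
    refine hwinj (hσd 0 h0) h0 ?_
    rw [hsum 0 h0, hw' h0]
    have : Finset.Iic (⟨0, h0⟩ : Fin d) = {⟨0, h0⟩} := by
      ext i
      simp [Fin.le_def, Fin.ext_iff]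
    rw [this, Finset.sum_singleton]
  have hfalse := searchFails_eq_false h2 (w := w') (σ := σ)
    (fun i hi => by rw [hw' hi]; exact hw0 _) hwinj hσd
    (by
      intro a ha b hb h
      rw [hσ' ha, hσ' hb] at h
      exact Fin.mk.inj_iff.1 (hτinj (Fin.ext h)))
    (by
      intro a ha
      rw [hsum _ ha, hsum a (by omega), hw' ha]
      have : Finset.Iic (⟨a + 1, ha⟩ : Fin d) =
          insert ⟨a + 1, ha⟩ (Finset.Iic (⟨a, by omega⟩ : Fin d)) := by
        ext i
        simp [Fin.le_def, Fin.ext_iff]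
        omega
      rw [this, Finset.sum_insert (by simp [Fin.le_def]), add_comm])
    (d - 1) 0 ((List.range d).map (2 ^ ·)) (List.range d).tail (by omega)
    (by
      rw [List.map_map]
      exact List.map_congr_left fun i hi => bitSum_two_pow w' (List.mem_range.1 hi))
    (by
      intro b hb hbd
      have hne : σ b ≠ 0 := by
        intro h
        rw [← hσ0, hσ' hbd, hσ' h0] at h
        have := Fin.mk.inj_iff.1 (hτinj (Fin.ext h))
        omega
      have hmem : σ b ∈ List.range d := List.mem_range.2 (hσd b hbd)
      obtain ⟨e, rfl⟩ : ∃ e, d = e + 1 := ⟨d - 1, by omega⟩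
      rw [List.range_succ_eq_map] at hmem ⊢
      simpa [hne] using hmem)
  rw [hσ0, searchFails_start hd4 hd9] at hfalse
  exact Bool.noConfusion hfalse

/-! ### Rainbow brooms in the cube -/

/-- The neighbour of the vertex `j` of a broom on the way to the centre `0`. -/
def broomParent {k : ℕ} (l : ℕ) (j : Fin (k + 1)) : Fin (k + 1) :=
  if j.val ≤ l then ⟨j.val - 1, by omega⟩ else 0

theorem broomParent_zero {k : ℕ} (l : ℕ) : broomParent l (0 : Fin (k + 1)) = 0 := by
  simp [broomParent]

theorem broomParent_lt {k : ℕ} (l : ℕ) {j : Fin (k + 1)} (hj : j ≠ 0) : broomParent l j < j := by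
  have : j.val ≠ 0 := fun h => hj (Fin.ext h)
  unfold broomParent
  split_ifs
  · rw [Fin.lt_def]
    simp only
    omega
  · exact Fin.pos_of_ne_zero hj

theorem broom_adj_broomParent {k : ℕ} (l : ℕ) {j : Fin (k + 1)} (hj : j ≠ 0) :
    (broom k l).Adj j (broomParent l j) := by
  have h0 : j.val ≠ 0 := fun h => hj (Fin.ext h)
  rw [broom, SimpleGraph.fromRel_adj]
  refine ⟨(broomParent_lt l hj).ne', Or.inr ?_⟩
  unfold broomParent
  split_ifs with h
  · left
    simp only
    omega
  · right
    simp
    omega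

/-- The parent is the smaller endpoint, so an edge determines its child. -/
theorem eq_of_broomParent_edge_eq {k l : ℕ} {i j : Fin (k + 1)} (hi : i ≠ 0) (hj : j ≠ 0)
    (h : s(i, broomParent l i) = s(j, broomParent l j)) : i = j := by
  rcases Sym2.eq_iff.1 h with h | ⟨h1, h2⟩
  · exact h.1
  · have h3 := broomParent_lt l hi
    have h4 := broomParent_lt l hj
    rw [← h1] at h4
    rw [h2] at h3
    exact absurd (h3.trans h4) (lt_irrefl _)

/-- A function on the vertices of a broom that is constant along edges is constant. -/
theorem eq_apply_zero_of_broom_adj {α : Type*} {k l : ℕ} {f : Fin (k + 1) → α}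
    (hf : ∀ i j, (broom k l).Adj i j → f i = f j) (j : Fin (k + 1)) : f j = f 0 := by
  induction j using WellFoundedLT.induction with
  | ind j ih =>
    by_cases hj : j = 0
    · rw [hj]
    · exact (hf _ _ (broom_adj_broomParent l hj)).trans (ih _ (broomParent_lt l hj))

theorem sum_Iic_fin {M : Type*} [AddCommMonoid M] {d : ℕ} (a : Fin d) (F : ℕ → M) :
    ∑ i ∈ Finset.Iic a, F i = ∑ i ∈ Finset.range (a + 1), F i := by
  refine Finset.sum_bij (fun i _ => i.val) ?_ ?_ ?_ ?_
  · intro i hi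
    have := Fin.le_def.1 (Finset.mem_Iic.1 hi)
    simpa using Nat.lt_succ_of_le this
  · exact fun i _ j _ h => Fin.ext h
  · intro b hb
    have hb := Finset.mem_range.1 hb
    exact ⟨⟨b, by omega⟩, by simp [Fin.le_def]; omega, rfl⟩
  · exact fun _ _ => rfl

/-- The cube `K*_{2^s}` contains no rainbow broom with `2 ^ s - 1` edges and stick length `d`,
`4 ≤ d ≤ 9`. -/
theorem not_hasRainbowCopy_broom_cubeColoring {d s k : ℕ} (hd4 : 4 ≤ d) (hd9 : d ≤ 9)
    (hk : k = 2 ^ s - 1) (hdk : d ≤ k) : ¬ HasRainbowCopy (broom k d) (cubeColoring s) := by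
  rintro ⟨φ, hφ⟩
  have hφinj : Function.Injective φ.toHom := φ.injective'
  -- The color of the edge from `j` to its parent. The value `f 0 = 0` supplies the one vector that
  -- is not a color, so `f` is a bijection by counting.
  let f : Fin (k + 1) → Fin s → ZMod 2 := fun j => φ.toHom j - φ.toHom (broomParent d j)
  have hf0 : f 0 = 0 := by simp [f, broomParent_zero]
  have hfne : ∀ j, j ≠ 0 → f j ≠ 0 := fun j hj h =>
    (broomParent_lt d hj).ne' (hφinj (sub_eq_zero.1 h))
  have hfinj : Function.Injective f := by
    intro i j h
    by_cases hi : i = 0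
    · by_contra hne
      exact hfne j (fun hj => hne (hi.trans hj.symm)) (by rw [← h, hi, hf0])
    by_cases hj : j = 0
    · exact absurd (by rw [h, hj, hf0]) (hfne i hi)
    have := @hφ ⟨s(i, broomParent d i), broom_adj_broomParent d hi⟩
      ⟨s(j, broomParent d j), broom_adj_broomParent d hj⟩ h
    exact eq_of_broomParent_edge_eq hi hj (congrArg Subtype.val this)
  have hpow : 0 < 2 ^ s := by positivity
  have hfsurj : Function.Surjective f := by
    refine ((Fintype.bijective_iff_injective_and_card f).2 ⟨hfinj, ?_⟩).2
    simp [ZMod.card]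
    omega
  let ψ : ℕ → Fin s → ZMod 2 := fun n => φ.toHom (Fin.ofNat (k + 1) n)
  have hofNat : ∀ n, n ≤ k → (Fin.ofNat (k + 1) n).val = n := fun n hn =>
    Nat.mod_eq_of_lt (by omega)
  have hψinj : ∀ m n, m ≤ k → n ≤ k → ψ m = ψ n → m = n := by
    intro m n hm hn h
    have := congrArg Fin.val (hφinj h)
    rwa [hofNat m hm, hofNat n hn] at this
  have hfψ : ∀ n, n < d → f (Fin.ofNat (k + 1) (n + 1)) = ψ (n + 1) - ψ n := by
    intro n hn
    have : broomParent d (Fin.ofNat (k + 1) (n + 1)) = Fin.ofNat (k + 1) n := by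
      apply Fin.ext
      rw [broomParent, hofNat n (by omega), if_pos (by rw [hofNat _ (by omega)]; omega)]
      simp only [hofNat (n + 1) (by omega)]
      omega
    simp only [f, ψ, this]
  have hsum : ∀ a : Fin d, ∑ i ∈ Finset.Iic a, (ψ (i + 1) - ψ i) = ψ (a + 1) - ψ 0 := by
    intro a
    rw [sum_Iic_fin a (fun i => ψ (i + 1) - ψ i), Finset.sum_range_sub]
  refine not_exists_partialSums_mem (M := Fin s → ZMod 2)
    (fun x => funext fun i => (by decide : ∀ y : ZMod 2, y + y = 0) (x i)) hd4 hd9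
    ⟨fun i => ψ (i + 1) - ψ i, ?_, ?_, ?_, ?_⟩
  · intro i j h
    simp only [← hfψ _ (Fin.is_lt _)] at h
    have := congrArg Fin.val (hfinj h)
    rw [hofNat _ (by omega), hofNat _ (by omega)] at this
    exact Fin.ext (by omega)
  · intro i h
    have := hψinj _ _ (by omega) (by omega) (sub_eq_zero.1 h)
    omega
  · intro a b h
    simp only [hsum] at h
    have := hψinj _ _ (by omega) (by omega) (sub_left_injective h)
    exact Fin.ext (by omega)
  · intro a
    rw [hsum]
    obtain ⟨j, hj⟩ := hfsurj (ψ (a + 1) - ψ 0)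
    have hj0 : j.val ≠ 0 := by
      intro h
      rw [show j = 0 from Fin.ext h, hf0] at hj
      have := hψinj _ _ (by omega) (by omega) (sub_eq_zero.1 hj.symm)
      omega
    by_cases hjd : j.val ≤ d
    · refine ⟨⟨j.val - 1, by omega⟩, ?_⟩
      simp only
      rw [← hj, ← hfψ _ (by omega)]
      congr 1
      apply Fin.ext
      rw [hofNat _ (by omega)]
      omega
    -- If the color belonged to a leaf `j`, then `j` would have the same image as the stick vertex
    -- `a + 1`.
    · have hp : broomParent d j = Fin.ofNat (k + 1) 0 := by
        simp [broomParent, hjd]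
      have h1 : φ.toHom j = ψ (a + 1) := by
        simp only [f, hp] at hj
        exact sub_left_injective hj
      have := congrArg Fin.val (hφinj h1)
      rw [hofNat _ (by omega)] at this
      omega

theorem isProper_cubeColoring (s : ℕ) : IsProper (cubeColoring s) := by
  rintro ⟨e, he⟩ ⟨f, hf⟩ hne ⟨v, hve, hvf⟩ h
  obtain ⟨x, rfl⟩ := Sym2.mem_iff_exists.1 hve
  obtain ⟨y, rfl⟩ := Sym2.mem_iff_exists.1 hvf
  have hxy : v - x = v - y := h
  exact hne (by simp [sub_right_injective hxy])

/-! ### Disjoint copies of the cube and the lower bound -/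

/-- The disjoint union of cliques on the consecutive blocks of length `b` in `0, …, n - 1`. -/
def blockGraph (n b : ℕ) : SimpleGraph (Fin n) where
  Adj i j := i ≠ j ∧ i.val / b = j.val / b
  symm := ⟨fun _ _ h => ⟨h.1.symm, h.2.symm⟩⟩
  loopless := ⟨fun _ h => h.1 rfl⟩

theorem le_degree_blockGraph {n b : ℕ} [DecidableRel (blockGraph n b).Adj] (i : Fin n)
    (hi : i.val < b * (n / b)) : b - 1 ≤ (blockGraph n b).degree i := by
  have hb : 0 < b := Nat.pos_of_ne_zero fun h => by simp [h] at hi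
  have hq : i.val / b + 1 ≤ n / b := Nat.div_lt_of_lt_mul hi
  have hn : b * (i.val / b) + b ≤ n := by
    calc b * (i.val / b) + b = b * (i.val / b + 1) := by ring
      _ ≤ b * (n / b) := Nat.mul_le_mul_left b hq
      _ ≤ n := Nat.mul_div_le n b
  have hsub : Finset.univ.image (fun r : Fin b => (⟨b * (i.val / b) + r, by omega⟩ : Fin n)) ⊆
      insert i ((blockGraph n b).neighborFinset i) := by
    intro j hj
    obtain ⟨r, -, rfl⟩ := Finset.mem_image.1 hj
    rw [Finset.mem_insert, SimpleGraph.mem_neighborFinset]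
    refine or_iff_not_imp_left.2 fun h => ⟨fun h' => h h'.symm, ?_⟩
    simp [Nat.mul_add_div hb, Nat.div_eq_of_lt r.2]
  have hcard := (Finset.card_le_card hsub).trans (Finset.card_insert_le _ _)
  rw [Finset.card_image_of_injective _ (fun x y h => by
    simpa [Fin.ext_iff] using h), Finset.card_univ, Fintype.card_fin,
    SimpleGraph.card_neighborFinset_eq_degree] at hcard
  omega

theorem le_two_mul_ncard_edgeSet_blockGraph (n b : ℕ) :
    (b - 1) * (b * (n / b)) ≤ 2 * (blockGraph n b).edgeSet.ncard := by
  classical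
  rw [← SimpleGraph.coe_edgeFinset, Set.ncard_coe_finset,
    ← SimpleGraph.sum_degrees_eq_twice_card_edges]
  have hcard : ((Finset.univ : Finset (Fin n)).filter (·.val < b * (n / b))).card =
      b * (n / b) := by
    rw [Fin.card_filter_val_lt]
    exact min_eq_right (Nat.mul_div_le n b)
  calc (b - 1) * (b * (n / b))
      = ∑ _i ∈ (Finset.univ : Finset (Fin n)).filter (·.val < b * (n / b)), (b - 1) := by
        rw [Finset.sum_const, hcard, smul_eq_mul, mul_comm]
    _ ≤ ∑ i ∈ (Finset.univ : Finset (Fin n)).filter (·.val < b * (n / b)),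
          (blockGraph n b).degree i :=
        Finset.sum_le_sum fun i hi => le_degree_blockGraph i (Finset.mem_filter.1 hi).2
    _ ≤ ∑ i, (blockGraph n b).degree i :=
        Finset.sum_le_sum_of_subset (Finset.filter_subset _ _)

/-- If `K*_{2^s}` contains no rainbow broom, then neither do disjoint unions of copies of it. -/
theorem ncard_edgeSet_blockGraph_mem_rainbowFreeSizes {s k l : ℕ}
    (h : ¬ HasRainbowCopy (broom k l) (cubeColoring s)) (n : ℕ) :
    (blockGraph n (2 ^ s)).edgeSet.ncard ∈ rainbowFreeSizes n (broom k l) := by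
  have hpow : 0 < 2 ^ s := by positivity
  let e : Fin (2 ^ s) ≃ (Fin s → ZMod 2) := Fintype.equivOfCardEq (by simp [ZMod.card])
  let ρ : Fin n → (Fin s → ZMod 2) := fun i => e ⟨i.val % 2 ^ s, Nat.mod_lt _ hpow⟩
  have hρ : ∀ i j : Fin n, i.val / 2 ^ s = j.val / 2 ^ s → ρ i = ρ j → i = j := by
    intro i j hij hρij
    have hmod : i.val % 2 ^ s = j.val % 2 ^ s := Fin.mk.inj_iff.1 (e.injective hρij)
    apply Fin.ext
    rw [← Nat.div_add_mod i.val (2 ^ s), ← Nat.div_add_mod j.val (2 ^ s), hij, hmod]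
  let q : blockGraph n (2 ^ s) →g (⊤ : SimpleGraph (Fin s → ZMod 2)) :=
    ⟨ρ, fun {i j} hij => (SimpleGraph.top_adj _ _).2 fun hne => hij.1 (hρ i j hij.2 hne)⟩
  -- Colors must be natural numbers, so vectors are encoded through `e.symm`.
  have henc : Function.Injective fun x : Fin s → ZMod 2 => (e.symm x).val :=
    Fin.val_injective.comp e.symm.injective
  refine ⟨blockGraph n (2 ^ s), fun x => (e.symm (cubeColoring s (q.mapEdgeSet x))).val,
    ?_, ?_, rfl⟩
  · rintro ⟨x, hx⟩ ⟨y, hy⟩ hne ⟨v, hvx, hvy⟩ hc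
    obtain ⟨x, rfl⟩ := Sym2.mem_iff_exists.1 hvx
    obtain ⟨y, rfl⟩ := Sym2.mem_iff_exists.1 hvy
    refine isProper_cubeColoring s (q.mapEdgeSet ⟨s(v, x), hx⟩) (q.mapEdgeSet ⟨s(v, y), hy⟩) ?_
      ⟨ρ v, Sym2.mem_mk_left _ _, Sym2.mem_mk_left _ _⟩ (henc hc)
    intro heq
    have hxy : ρ x = ρ y := Sym2.congr_right.1 (congrArg Subtype.val heq)
    have hvx : v.val / 2 ^ s = x.val / 2 ^ s := And.right hx
    have hvy : v.val / 2 ^ s = y.val / 2 ^ s := And.right hy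
    exact hne (by simp [hρ x y (hvx.symm.trans hvy) hxy])
  · rintro ⟨φ, hφ⟩
    have hblock := eq_apply_zero_of_broom_adj (k := k) (l := l)
      (f := fun j => (φ.toHom j).val / 2 ^ s) fun i j hij => And.right (φ.toHom.map_rel hij)
    refine h ⟨⟨q.comp φ.toHom, fun i j hij => φ.injective' ?_⟩, fun x y hxy => hφ ?_⟩
    · exact hρ _ _ ((hblock i).trans (hblock j).symm) hij
    · obtain ⟨⟨a, b⟩, hx⟩ := x
      obtain ⟨⟨a', b'⟩, hy⟩ := y
      exact congrArg (fun x => (e.symm x).val) hxy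

end RainbowTuran

theorem mainTheorem6 (d s k : ℕ) (hd4 : 4 ≤ d) (hd9 : d ≤ 9) (hs : 2 ≤ s)
    (hk : k = 2 ^ s - 1) (hdk : d ≤ k) :
    (∃ C : ℝ, ∀ n : ℕ,
      (k : ℝ) / 2 * n - C ≤ (RainbowTuran.exStar n (RainbowTuran.broom k d) : ℝ)) ∧
    ¬ RainbowTuran.HasRainbowCopy (RainbowTuran.broom k d) (RainbowTuran.cubeColoring s) ∧
    (∀ m : ℕ, ¬ ∃ w : Fin d → (Fin m → ZMod 2),
      Function.Injective w ∧ (∀ i, w i ≠ 0) ∧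
      Function.Injective (fun a : Fin d => ∑ i ∈ Finset.Iic a, w i) ∧
      ∀ a : Fin d, ∑ i ∈ Finset.Iic a, w i ∈ Set.range w) := by
  have hfree := RainbowTuran.not_hasRainbowCopy_broom_cubeColoring hd4 hd9 hk hdk
  -- Fewer than `2 ^ s` vertices lie outside the full blocks, and each costs at most `k / 2` edges
  -- in the bound.
  refine ⟨⟨(k : ℝ) / 2 * 2 ^ s, fun n => ?_⟩, hfree, fun m =>
    RainbowTuran.not_exists_partialSums_mem
      (fun x => funext fun i => (by decide : ∀ y : ZMod 2, y + y = 0) (x i)) hd4 hd9⟩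
  have h1 : (RainbowTuran.blockGraph n (2 ^ s)).edgeSet.ncard ≤
      RainbowTuran.exStar n (RainbowTuran.broom k d) :=
    le_csSup (RainbowTuran.bddAbove_rainbowFreeSizes n _)
      (RainbowTuran.ncard_edgeSet_blockGraph_mem_rainbowFreeSizes hfree n)
  have h2 := RainbowTuran.le_two_mul_ncard_edgeSet_blockGraph n (2 ^ s)
  rw [← hk] at h2
  have h3 : n ≤ 2 ^ s * (n / 2 ^ s) + 2 ^ s := by
    have := Nat.div_add_mod n (2 ^ s)
    have := Nat.mod_lt n (show 0 < 2 ^ s by positivity)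
    omega
  have h4 : k * n ≤ 2 * RainbowTuran.exStar n (RainbowTuran.broom k d) + k * 2 ^ s := by
    calc k * n ≤ k * (2 ^ s * (n / 2 ^ s) + 2 ^ s) := Nat.mul_le_mul_left k h3
      _ = k * (2 ^ s * (n / 2 ^ s)) + k * 2 ^ s := by ring
      _ ≤ _ := by omega
  have h5 : (k : ℝ) * n ≤ 2 * RainbowTuran.exStar n (RainbowTuran.broom k d) + k * 2 ^ s := by
    exact_mod_cast h4
  linarith
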